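/- Let $X$ be an $n$-dimensional complex manifold, $1\le k\le n$, and let $\omega$ be a holomorphic Pfaff system of rank $k$ on $X$: a non-trivial section of $\Omega^k_X\otimes\mathcal N$, $\mathcal N$ a holomorphic line bundle, given on an open covering $\{U_\alpha\}$ by holomorphic $k$-forms $\omega_\alpha$ with $\omega_\alpha=h_{\alpha\beta}\,\omega_\beta$, where $(h_{\alpha\beta})$ is a cocycle of $\mathcal N$. Let $\mathrm{Sing}(\omega)$ be the zero set of $\omega$. Let $V\subset X$ be a reduced local complete intersection subvariety of pure codimension $k$ which is invariant by $\omega$, i.e. the pull-back of $\omega$ to (the regular part of) $V$ vanishes identically. Let $\mathrm{Sing}(V)$ be the set of the points at which $V$ is not a submanifold, and let $S$ be an irreducible component of $\mathrm{Sing}(\omega)\cap V$. An Aleksandrov–Saito decomposition of $\omega$ on an open set $W\subset U_\alpha$ is an identity $$g\,\omega_\alpha=\xi\,df_1\wedge\cdots\wedge df_k+f_1\eta_1+\cdots+f_k\eta_k ,$$ where $f_1,\dots,f_k\in\mathcal O(W)$ have the zero set $V\cap W$ and generate the ideal of $V$ at each point of $V\cap W$, $g,\xi\in\mathcal O(W)$,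 $g$ vanishes identically on no irreducible component of $V\cap W$, and $\eta_1,\dots,\eta_k$ are holomorphic $k$-forms on $W$. If $W\cap S\ne\emptyset$, its index is $$\mathrm{GSV}(\omega,V,S)=\mathrm{ord}_S\Big(\frac{\xi}{g}\Big|_V\Big)=\mathrm{ord}_S(\xi|_V)-\mathrm{ord}_S(g|_V)\in\mathbb Z\cup\{\infty\},$$ defined when $\mathrm{ord}_S(g|_V)<\infty$. Here $\mathrm{ord}_S$ is computed at a point $x\in W\cap S$ along a local irreducible component of $S$ at $x$: $\mathrm{ord}_S(a)$ is the length of $R/(a)$, where $R$ is the localization of $\mathcal O_{V,x}$ at the prime ideal of that local component, and $\mathrm{ord}_S(a)=\infty$ if $a=0$ in $R$. If $S\cap\mathrm{Sing}(V)=\emptyset$, then $\mathrm{GSV}(\omega,V,S)\ge 0$ for every Aleksandrov–Saito decomposition and every such point $x$ and local component for which it is defined. Moreover, in this case such an index exists, provided that near each point of $V$, for some local equations $f_1,\dots,f_k$ of $V$ as above, one has $df_i\wedge\omega_\alpha\in f_1\Omega^{k+1}_X+\cdots+f_k\Omega^{k+1}_X$ for $i=1,\dots,k$. -/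

import Mathlib

open scoped Manifold Topology

noncomputable section

namespace PfaffGSV

/-- The model space of `n`-dimensional complex manifolds. -/
abbrev Mdl (n : ℕ) : Type := EuclideanSpace ℂ (Fin n)

section Basic

variable {n : ℕ} {X : Type*} [TopologicalSpace X] [ChartedSpace (Mdl n) X]

/-- `f` is holomorphic near `x` (order of smoothness `⊤`, that is, analytic in charts). -/
def HolAt (n : ℕ) {X : Type*} [TopologicalSpace X] [ChartedSpace (Mdl n) X]
    (f : X → ℂ) (x : X) : Prop :=
  ContMDiffAt 𝓘(ℂ, Mdl n) 𝓘(ℂ) ⊤ f x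

/-- `f` is holomorphic on `W` (used for open `W`). -/
def HolOn (n : ℕ) {X : Type*} [TopologicalSpace X] [ChartedSpace (Mdl n) X]
    (f : X → ℂ) (W : Set X) : Prop :=
  ∀ x ∈ W, HolAt n f x

/-- The holomorphic tangent space of `X` at `x`. -/
abbrev TS (n : ℕ) {X : Type*} [TopologicalSpace X] [ChartedSpace (Mdl n) X] (x : X) : Type :=
  TangentSpace 𝓘(ℂ, Mdl n) x

/-- The differential `df` at `x`, as a linear form on the tangent space. -/
def dAt (n : ℕ) {X : Type*} [TopologicalSpace X] [ChartedSpace (Mdl n) X]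
    (f : X → ℂ) (x : X) : TS n x →ₗ[ℂ] ℂ :=
  (mfderiv 𝓘(ℂ, Mdl n) 𝓘(ℂ) f x).toLinearMap

/-- Fields of alternating `p`-forms on `X` (no regularity). -/
abbrev FormField (n p : ℕ) (X : Type*) [TopologicalSpace X] [ChartedSpace (Mdl n) X] : Type _ :=
  ∀ x : X, (TS n x) [⋀^Fin p]→ₗ[ℂ] ℂ

/-- A field of `p`-forms is holomorphic on the open set `W`: in each chart of the atlas all the
coefficients of its pull-back under the inverse of the chart are holomorphic. -/
def HolFormOn {p : ℕ} (θ : FormField n p X) (W : Set X) : Prop :=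
  ∀ x₀ : X, ∀ v : Fin p → Mdl n,
    ContDiffOn ℂ ⊤
      (fun z : Mdl n => θ ((chartAt (Mdl n) x₀).symm z)
        (fun j => mfderiv 𝓘(ℂ, Mdl n) 𝓘(ℂ, Mdl n) (chartAt (Mdl n) x₀).symm z (v j)))
      ((chartAt (Mdl n) x₀).target ∩ (chartAt (Mdl n) x₀).symm ⁻¹' W)

/-- `df₁ ∧ ⋯ ∧ dfₖ` at `x`, that is, `(v₁, …, vₖ) ↦ det (dfᵢ(vⱼ))`. -/
def dWedge {k : ℕ} (f : Fin k → X → ℂ) (x : X) : (TS n x) [⋀^Fin k]→ₗ[ℂ] ℂ :=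
  Matrix.detRowAlternating.compLinearMap (LinearMap.pi fun i => dAt n (f i) x)

/-- `df ∧ θ` at `x`, for a `p`-form `θ` at `x`:
`(v₀, …, vₚ) ↦ ∑ⱼ (-1)ʲ df(vⱼ) θ(v₀, …, v̂ⱼ, …, vₚ)`. -/
def wedgeDf {p : ℕ} (f : X → ℂ) (x : X) (θ : (TS n x) [⋀^Fin p]→ₗ[ℂ] ℂ) :
    (TS n x) [⋀^Fin (p + 1)]→ₗ[ℂ] ℂ :=
  AlternatingMap.alternatizeUncurryFin ((dAt n f x).smulRight θ)

end Basic

/-- A holomorphic Pfaff system of rank `p` on `X`: a non-trivial section of `Ω^p_X ⊗ N`, where the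
line bundle `N` is given by an open covering and a cocycle `h`, and the section by holomorphic
`p`-forms `form α` on the members of the covering. -/
structure PfaffSystem (n p : ℕ) (X : Type*) [TopologicalSpace X] [ChartedSpace (Mdl n) X]
    (ι : Type*) where
  U : ι → Set X
  isOpen_U : ∀ α, IsOpen (U α)
  cover : ∀ x, ∃ α, x ∈ U α
  h : ι → ι → X → ℂ
  hol_h : ∀ α β, HolOn n (h α β) (U α ∩ U β)
  h_ne_zero : ∀ α β, ∀ x ∈ U α ∩ U β, h α β x ≠ 0
  cocycle : ∀ α β γ, ∀ x ∈ U α ∩ U β ∩ U γ, h α β x * h β γ x = h α γ x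
  form : ι → FormField n p X
  hol_form : ∀ α, HolFormOn (form α) (U α)
  form_eq : ∀ α β, ∀ x ∈ U α ∩ U β, form α x = h α β x • form β x
  nontrivial : ∃ α, ∃ x ∈ U α, form α x ≠ 0

section Geometry

variable {n : ℕ} {X : Type*} [TopologicalSpace X] [ChartedSpace (Mdl n) X]

/-- The singular set (zero set) of a Pfaff system. -/
def PfaffSystem.sing {p : ℕ} {ι : Type*} (Ω : PfaffSystem n p X ι) : Set X :=
  {x | ∃ α, x ∈ Ω.U α ∧ Ω.form α x = 0}

/-- Closed analytic subsets of `X`. -/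
def IsAnalyticSubset (n : ℕ) {X : Type*} [TopologicalSpace X] [ChartedSpace (Mdl n) X]
    (A : Set X) : Prop :=
  IsClosed A ∧ ∀ x ∈ A, ∃ W : Set X, IsOpen W ∧ x ∈ W ∧ ∃ (r : ℕ) (f : Fin r → X → ℂ),
    (∀ i, HolOn n (f i) W) ∧ A ∩ W = {y ∈ W | ∀ i, f i y = 0}

/-- Irreducible analytic subsets of `X`. -/
def IsIrreducibleAnalytic (n : ℕ) {X : Type*} [TopologicalSpace X] [ChartedSpace (Mdl n) X]
    (A : Set X) : Prop :=
  IsAnalyticSubset n A ∧ A.Nonempty ∧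
    ∀ B C : Set X, IsAnalyticSubset n B → IsAnalyticSubset n C → A ⊆ B ∪ C → A ⊆ B ∨ A ⊆ C

/-- The irreducible components of `A`: the maximal irreducible analytic subsets of `A`. -/
def IsIrreducibleComponent (n : ℕ) {X : Type*} [TopologicalSpace X] [ChartedSpace (Mdl n) X]
    (A S : Set X) : Prop :=
  Maximal (fun B => IsIrreducibleAnalytic n B ∧ B ⊆ A) S

/-- Near `x`, the set `V` is a complex submanifold of codimension `r` passing through `x`. -/
def IsRegularPoint (n : ℕ) {X : Type*} [TopologicalSpace X] [ChartedSpace (Mdl n) X]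
    (V : Set X) (x : X) (r : ℕ) : Prop :=
  x ∈ V ∧ ∃ W : Set X, IsOpen W ∧ x ∈ W ∧ ∃ h : Fin r → X → ℂ,
    (∀ i, HolOn n (h i) W) ∧ V ∩ W = {y ∈ W | ∀ i, h i y = 0} ∧
    LinearIndependent ℂ (fun i => dAt n (h i) x)

/-- The singular locus of an analytic subset `V`: the points where `V` is not a submanifold. -/
def singularLocus (n : ℕ) {X : Type*} [TopologicalSpace X] [ChartedSpace (Mdl n) X]
    (V : Set X) : Set X :=
  {x ∈ V | ¬ ∃ r, IsRegularPoint n V x r}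

/-- `f₁, …, fₖ` are holomorphic on the open set `W`, have the zero set `V ∩ W`, and generate the
ideal of the holomorphic functions vanishing on `V` at each point of `V ∩ W`
(so that `f = 0` is `V` with its reduced structure). -/
structure IsLocalEquations {k : ℕ} (V W : Set X) (f : Fin k → X → ℂ) : Prop where
  isOpen : IsOpen W
  hol : ∀ i, HolOn n (f i) W
  zeros : V ∩ W = {y ∈ W | ∀ i, f i y = 0}
  generates : ∀ y ∈ V ∩ W, ∀ u : X → ℂ, HolAt n u y → (∀ᶠ z in 𝓝[V] y, u z = 0) →
    ∃ c : Fin k → X → ℂ, (∀ i, HolAt n (c i) y) ∧ ∀ᶠ z in 𝓝 y, u z = ∑ i, c i z * f i z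

/-- `V` is a reduced local complete intersection subvariety of pure codimension `k`: it is closed,
near each of its points its ideal is generated by `k` functions, and its dimension is `n - k` at
all its regular points (which are dense in it). -/
structure IsReducedLCI (n : ℕ) {X : Type*} [TopologicalSpace X] [ChartedSpace (Mdl n) X]
    (V : Set X) (k : ℕ) : Prop where
  isClosed : IsClosed V
  exists_equations : ∀ x ∈ V, ∃ (W : Set X) (f : Fin k → X → ℂ),
    x ∈ W ∧ IsLocalEquations (n := n) V W f
  pure_codim : ∀ x r, IsRegularPoint n V x r → r = k

/-- A vector `v` at `x` is tangent to `V`: it is annihilated by the differentials of the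
holomorphic functions near `x` that vanish on `V`. -/
def IsTangentTo (V : Set X) (x : X) (v : TS n x) : Prop :=
  ∀ u : X → ℂ, HolAt n u x → (∀ᶠ z in 𝓝[V] x, u z = 0) → dAt n u x v = 0

/-- `V` is invariant by the Pfaff system: the pull-back of the system to (the regular part of) `V`
vanishes identically. -/
def PfaffSystem.IsInvariant {p : ℕ} {ι : Type*} (Ω : PfaffSystem n p X ι) (V : Set X) : Prop :=
  ∀ α, ∀ x ∈ Ω.U α, (∃ r, IsRegularPoint n V x r) →
    ∀ v : Fin p → TS n x, (∀ j, IsTangentTo V x (v j)) → Ω.form α x v = 0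

/-- Near each point of `V`, for some local equations `f₁, …, fₖ` of `V`, the forms `dfᵢ ∧ ω_α`
belong to the module `f₁ Ω^{p+1} + ⋯ + fₖ Ω^{p+1}`. -/
def PfaffSystem.IsLogarithmicAlong {p : ℕ} {ι : Type*} (Ω : PfaffSystem n p X ι)
    (V : Set X) (k : ℕ) : Prop :=
  ∀ x ∈ V, ∃ (α : ι) (W : Set X) (f : Fin k → X → ℂ)
    (θ : Fin k → Fin k → FormField n (p + 1) X),
    x ∈ W ∧ W ⊆ Ω.U α ∧ IsLocalEquations (n := n) V W f ∧ (∀ i j, HolFormOn (θ i j) W) ∧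
    ∀ i, ∀ y ∈ W, wedgeDf (f i) y (Ω.form α y) = ∑ j, f j y • θ i j y

/-- An Aleksandrov-Saito decomposition
`g ω_α = ξ df₁ ∧ ⋯ ∧ dfₖ + f₁ η₁ + ⋯ + fₖ ηₖ` on an open subset `W` of `U_α`, where `f = 0` are
local equations of `V` on `W` and `g` does not vanish identically on any irreducible component of
`V ∩ W` (that is, on any non-empty open subset of `V ∩ W`). -/
structure IsASDecomposition {k : ℕ} {ι : Type*} (Ω : PfaffSystem n k X ι) (V : Set X) (α : ι)
    (W : Set X) (f : Fin k → X → ℂ) (g ξ : X → ℂ) (η : Fin k → FormField n k X) : Prop where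
  subset : W ⊆ Ω.U α
  equations : IsLocalEquations (n := n) V W f
  hol_g : HolOn n g W
  hol_ξ : HolOn n ξ W
  hol_η : ∀ i, HolFormOn (η i) W
  g_ne_zero : V ∩ W ⊆ closure {y ∈ V ∩ W | g y ≠ 0}
  decomp : ∀ y ∈ W, g y • Ω.form α y = ξ y • dWedge f y + ∑ i, f i y • η i y

end Geometry

section Order

variable {n : ℕ} {X : Type*} [TopologicalSpace X] [ChartedSpace (Mdl n) X]

/-- The local ring `𝒪_{V,x}` of the reduced analytic set `V`: germs at `x` of functions on `V`
that are restrictions of holomorphic functions on a neighbourhood of `x` in `X`. -/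
def localRing (n : ℕ) {X : Type*} [TopologicalSpace X] [ChartedSpace (Mdl n) X]
    (V : Set X) (x : X) : Subring (Filter.Germ (𝓝[V] x) ℂ) where
  carrier := {γ | ∃ f : X → ℂ, HolAt n f x ∧ (f : Filter.Germ (𝓝[V] x) ℂ) = γ}
  mul_mem' := by
    rintro _ _ ⟨f, hf, rfl⟩ ⟨g, hg, rfl⟩
    exact ⟨f * g, ContMDiffAt.mul hf hg, rfl⟩
  one_mem' := ⟨1, contMDiffAt_const, rfl⟩
  add_mem' := by
    rintro _ _ ⟨f, hf, rfl⟩ ⟨g, hg, rfl⟩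
    exact ⟨f + g, ContMDiffAt.add hf hg, rfl⟩
  zero_mem' := ⟨0, contMDiffAt_const, rfl⟩
  neg_mem' := by
    rintro _ ⟨f, hf, rfl⟩
    exact ⟨-f, ContMDiffAt.neg hf, rfl⟩

/-- The restriction to `V` of the germ at `x` of a holomorphic function. -/
def restrict {f : X → ℂ} {x : X} (V : Set X) (hf : HolAt n f x) : localRing n V x :=
  ⟨(f : Filter.Germ (𝓝[V] x) ℂ), f, hf, rfl⟩

/-- The ideal of `𝒪_{V,x}` of the germs vanishing on `S` (for `S ⊆ V`). -/
def idealOf (n : ℕ) {X : Type*} [TopologicalSpace X] [ChartedSpace (Mdl n) X]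
    (V S : Set X) (x : X) : Ideal (localRing n V x) where
  carrier := {γ | ∃ f : X → ℂ, (f : Filter.Germ (𝓝[V] x) ℂ) = γ.1 ∧ ∀ᶠ z in 𝓝[S] x, f z = 0}
  add_mem' := by
    rintro a b ⟨f, hf, hf0⟩ ⟨g, hg, hg0⟩
    refine ⟨f + g, ?_, ?_⟩
    · rw [Filter.Germ.coe_add, hf, hg]; rfl
    · filter_upwards [hf0, hg0] with z h1 h2
      simp [h1, h2]
  zero_mem' := ⟨0, rfl, by simp⟩
  smul_mem' := by
    rintro ⟨_, c, hc, rfl⟩ b ⟨f, hf, hf0⟩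
    refine ⟨c * f, ?_, ?_⟩
    · rw [Filter.Germ.coe_mul, hf]; rfl
    · filter_upwards [hf0] with z h1
      simp [h1]

open Classical in
/-- The order of vanishing of `a` at the prime ideal `Q` of a ring `R`: the length of
`R_Q / (a)`, with the convention that the order of `0` is infinite. -/
def orderAt {R : Type*} [CommRing R] (Q : Ideal R) [Q.IsPrime] (a : R) : ℕ∞ :=
  if algebraMap R (Localization.AtPrime Q) a = 0 then ⊤
  else Ring.ord (Localization.AtPrime Q) (algebraMap R (Localization.AtPrime Q) a)

/-- The inclusion of `ℕ ∪ {∞}` into `ℤ ∪ {∞}`. -/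
def toWithTopInt (a : ℕ∞) : WithTop ℤ := WithTop.map (Nat.cast : ℕ → ℤ) a

/-- `m` is the order `ord ξ - ord g` at `Q` of the fraction `ξ / g`, where `ord g` is finite. -/
def IsOrderOfFraction {R : Type*} [CommRing R] (Q : Ideal R) [Q.IsPrime] (ξ g : R)
    (m : WithTop ℤ) : Prop :=
  orderAt Q g ≠ ⊤ ∧ toWithTopInt (orderAt Q ξ) = m + toWithTopInt (orderAt Q g)

/-- `m` is a value of the GSV-index `GSV(Ω, V, S) = ord_S ((ξ / g)|_V)`, computed from some
Aleksandrov-Saito decomposition on some open set `W` meeting `S`. The order along `S` is taken in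
the local ring of `V` along (a local irreducible component at a point `x` of) `S`. -/
def IsGSVIndex {k : ℕ} {ι : Type*} (Ω : PfaffSystem n k X ι) (V S : Set X)
    (m : WithTop ℤ) : Prop :=
  ∃ (α : ι) (W : Set X) (f : Fin k → X → ℂ) (g ξ : X → ℂ) (η : Fin k → FormField n k X)
    (D : IsASDecomposition Ω V α W f g ξ η) (x : X) (_ : x ∈ S) (hxW : x ∈ W)
    (Q : Ideal (localRing n V x)) (_ : Q.IsPrime),
    Q ∈ (idealOf n V S x).minimalPrimes ∧
    IsOrderOfFraction Q (restrict V (D.hol_ξ x hxW)) (restrict V (D.hol_g x hxW)) m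

end Order

end PfaffGSV

end

/-! Every point `x` of `S` is a regular point of `V` of codimension `k`. There the differentials of
local equations are independent: the independent differentials of a submanifold's equations `h i`
lie in the span of the `df i`, because the `h i` lie in the ideal of `V`. Hence some fields `t`,
constant in a chart, satisfy `(df₁ ∧ ⋯ ∧ dfₖ)(t) ≠ 0` near `x`.

Non-negativity: evaluating a decomposition on `t` and restricting to `V` removes the `η i` and gives
`ξ = g · ω(t) / (df₁ ∧ ⋯ ∧ dfₖ)(t)`. So `g` divides `ξ` in the local ring of `V`
(`IsASDecomposition.restrict_dvd`), and orders grow under multiplication.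

Existence: the logarithmic condition gives `df i ∧ ω = 0` at points of `V`. Linear algebra
(`det_mul_eq_of_wedge_eq_zero`) then makes `ω` equal to `ξ df₁ ∧ ⋯ ∧ dfₖ` at those points, where `ξ`
is the quotient `ω(t) / (df₁ ∧ ⋯ ∧ dfₖ)(t)`. The coefficients of the difference vanish on `V`, so
they lie in the ideal of the `f i`. This is a decomposition with `g = 1`
(`exists_isASDecomposition`), whose index is the order of `ξ`. -/

noncomputable section

namespace PfaffGSV

/-! ### Alternating forms and independent linear forms -/

section LinearAlgebra

variable {K E : Type*} [Field K] [AddCommGroup E] [Module K E]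

/-- Linearly independent linear forms have a dual family of vectors. -/
theorem exists_dual_family {k : ℕ} {f : Fin k → E →ₗ[K] K} (hf : LinearIndependent K f) :
    ∃ t : Fin k → E, ∀ i j, f i (t j) = if i = j then 1 else 0 := by
  -- A proper range is killed by a nonzero functional `φ`, whose values on the unit vectors are the
  -- coefficients of a linear relation among the `f i`.
  have hsurj : LinearMap.range (LinearMap.pi f) = ⊤ := by
    by_contra hne
    obtain ⟨φ, hφ, hφ'⟩ :=
      Submodule.exists_dual_map_eq_bot_of_lt_top (lt_top_iff_ne_top.2 hne) inferInstance
    apply hφ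
    have hc : ∀ i, φ (Pi.single i 1) = 0 := by
      refine Fintype.linearIndependent_iff.1 hf _ ?_
      ext v
      have hv : φ (LinearMap.pi f v) = 0 :=
        (Submodule.eq_bot_iff _).1 hφ' _ ⟨_, ⟨v, rfl⟩, rfl⟩
      rw [← Finset.univ_sum_single (LinearMap.pi f v),
        map_sum] at hv
      rw [LinearMap.sum_apply, LinearMap.zero_apply, ← hv]
      refine Finset.sum_congr rfl fun i _ => ?_
      have : (Pi.single i (f i v) : Fin k → K) = f i v • Pi.single i 1 := by
        rw [← Pi.single_smul, smul_eq_mul, mul_one]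
      simp [this, mul_comm]
    refine LinearMap.pi_ext' fun i => LinearMap.ext_ring ?_
    simpa using hc i
  choose t ht using fun j : Fin k => LinearMap.range_eq_top.1 hsurj (Pi.single j 1)
  refine ⟨t, fun i j => ?_⟩
  have := congrFun (ht j) i
  simpa [Pi.single_apply] using this

/-- If `φ ∧ ω = 0`, then `ω` vanishes on the tuples of vectors annihilated by `φ ≠ 0`. -/
theorem apply_eq_zero_of_wedge_eq_zero {k : ℕ} {φ : E →ₗ[K] K} {ω : E [⋀^Fin k]→ₗ[K] K}
    (h : AlternatingMap.alternatizeUncurryFin (φ.smulRight ω) = 0) {t : E} (ht : φ t = 1)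
    {v : Fin k → E} (hv : ∀ j, φ (v j) = 0) : ω v = 0 := by
  -- On `(t, v)` every term of the alternating sum but the first contains some `φ (v j) = 0`; the
  -- first is `φ t * ω v`.
  have h0 := congrArg (fun θ => θ (Fin.cons t v : Fin (k + 1) → E)) h
  simp only [AlternatingMap.alternatizeUncurryFin_apply, Fin.sum_univ_succ] at h0
  simpa [ht, hv, Fin.removeNth_zero] using h0

/-- A `k`-form whose wedge products with `k` independent linear forms `f₁, …, fₖ` vanish is a
multiple of `f₁ ∧ ⋯ ∧ fₖ`. -/
theorem det_mul_eq_of_wedge_eq_zero {k : ℕ} {f : Fin k → E →ₗ[K] K} (hf : LinearIndependent K f)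
    {ω : E [⋀^Fin k]→ₗ[K] K}
    (h : ∀ i, AlternatingMap.alternatizeUncurryFin ((f i).smulRight ω) = 0) (t v : Fin k → E) :
    (Matrix.detRowAlternating.compLinearMap (LinearMap.pi f)) t * ω v =
      ω t * (Matrix.detRowAlternating.compLinearMap (LinearMap.pi f)) v := by
  obtain ⟨b, hb⟩ := exists_dual_family hf
  set δ : E [⋀^Fin k]→ₗ[K] K := Matrix.detRowAlternating.compLinearMap (LinearMap.pi f) with hδ
  have hδb : δ b = 1 := by
    have : (fun j => LinearMap.pi f (b j)) = (1 : Matrix (Fin k) (Fin k) K) := by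
      ext i j
      simp [hb, Matrix.one_apply, eq_comm]
    rw [hδ, AlternatingMap.compLinearMap_apply]
    exact (congrArg Matrix.det this).trans Matrix.det_one
  have hspan : ⊤ ≤ Submodule.span K (Set.range b ∪ {u | ∀ i, f i u = 0}) := by
    intro u _
    have hu : u = ∑ i, f i u • b i + (u - ∑ i, f i u • b i) := by abel
    rw [hu]
    refine Submodule.add_mem _ (Submodule.sum_mem _ fun i _ => Submodule.smul_mem _ _
      (Submodule.subset_span (Or.inl ⟨i, rfl⟩))) (Submodule.subset_span (Or.inr fun i => ?_))
    simp [hb]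
  -- Both sides are compared on a basis drawn from the dual vectors and the common kernel. A
  -- `k`-tuple of such vectors either permutes `b` or misses some `b i`; in the latter case `f i`
  -- kills the whole tuple, and both forms vanish on it.
  have key : ω = ω b • δ := by
    refine Module.Basis.ext_alternating (Module.Basis.ofSpan hspan) fun σ _ => ?_
    set w : Fin k → E := fun j => Module.Basis.ofSpan hspan (σ j) with hw
    have hwS : ∀ j, w j ∈ Set.range b ∪ {u | ∀ i, f i u = 0} := fun j =>
      Module.Basis.ofSpan_subset hspan ⟨_, rfl⟩
    rw [AlternatingMap.smul_apply, smul_eq_mul]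
    by_cases hall : ∀ i, ∃ j, w j = b i
    · choose π hπ using hall
      have hπi : Function.Injective π := by
        intro i i' hii
        by_contra hne
        have h1 := hb i i'
        rw [← hπ i', ← hii, hπ i, hb i i, if_pos rfl, if_neg hne] at h1
        exact one_ne_zero h1
      let e : Equiv.Perm (Fin k) := Equiv.ofBijective π (Finite.injective_iff_bijective.1 hπi)
      have hwe : w = b ∘ e.symm := by
        funext j
        have := hπ (e.symm j)
        rw [Function.comp_apply, ← this]
        exact congrArg w (e.apply_symm_apply j).symm
      rw [hwe, AlternatingMap.map_perm, AlternatingMap.map_perm, hδb]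
      rw [mul_smul_comm, mul_one]
    · push Not at hall
      obtain ⟨i, hi⟩ := hall
      have hz : ∀ j, f i (w j) = 0 := by
        intro j
        rcases hwS j with ⟨i', hi'⟩ | hj
        · rw [← hi', hb, if_neg]
          rintro rfl
          exact hi j hi'.symm
        · exact hj i
      rw [apply_eq_zero_of_wedge_eq_zero (h i) (by simpa using hb i i) hz]
      have : δ w = 0 := by
        rw [hδ, AlternatingMap.compLinearMap_apply]
        exact Matrix.det_eq_zero_of_column_eq_zero i fun j => hz j
      rw [this, mul_zero]
  rw [key]
  simp only [AlternatingMap.smul_apply, smul_eq_mul]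
  ring

theorem alternatingMap_sum_apply {α ι F : Type*} [AddCommGroup F] [Module K F] (s : Finset α)
    (g : α → E [⋀^ι]→ₗ[K] F) (v : ι → E) : (∑ a ∈ s, g a) v = ∑ a ∈ s, g a v := by
  classical
  induction s using Finset.induction_on with
  | empty => simp
  | insert a s ha ih => simp [Finset.sum_insert ha, ih]

/-- The expansion of a form in the coordinates of a basis. -/
theorem factorial_smul_eq_sum {k : ℕ} {ι : Type*} [Fintype ι] [DecidableEq ι]
    (b : Module.Basis ι K E) (τ : E [⋀^Fin k]→ₗ[K] K) :
    (k.factorial : K) • τ = ∑ σ : Fin k → ι, τ (b ∘ σ) •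
      Matrix.detRowAlternating.compLinearMap (LinearMap.pi fun i => b.coord (σ i)) := by
  ext v
  -- The `k!` signed values of `τ` on permutations of `v` coincide. Expanding each in the basis and
  -- summing over `π` first turns the coordinate products into determinants.
  have hexp : ∀ π : Equiv.Perm (Fin k), ((π.sign : ℤ) : K) * τ (v ∘ π) =
      ((π.sign : ℤ) : K) * ∑ σ : Fin k → ι, τ (b ∘ σ) * ∏ i, b.coord (σ i) (v (π i)) := by
    intro π
    congr 1
    have hv : v ∘ π = fun i => ∑ a, b.coord a (v (π i)) • b a := by
      funext i
      simp [b.sum_repr]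
    rw [hv]
    have := τ.toMultilinearMap.map_sum (fun i (a : ι) => b.coord a (v (π i)) • b a)
    refine this.trans (Finset.sum_congr rfl fun σ _ => ?_)
    have h2 := τ.toMultilinearMap.map_smul_univ (fun i => b.coord (σ i) (v (π i))) (b ∘ σ)
    exact h2.trans (by rw [smul_eq_mul, mul_comm]; rfl)
  have hl : ∑ π : Equiv.Perm (Fin k), ((π.sign : ℤ) : K) * τ (v ∘ π) = k.factorial * τ v := by
    have : ∀ π : Equiv.Perm (Fin k), ((π.sign : ℤ) : K) * τ (v ∘ π) = τ v := by
      intro π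
      rw [AlternatingMap.map_perm]
      rcases Int.units_eq_one_or π.sign with h | h <;> simp [h]
    simp [this, Fintype.card_perm]
  rw [AlternatingMap.smul_apply, smul_eq_mul, ← hl, Finset.sum_congr rfl fun π _ => hexp π]
  simp only [Finset.mul_sum]
  rw [Finset.sum_comm]
  simp only [alternatingMap_sum_apply, AlternatingMap.smul_apply, smul_eq_mul]
  refine Finset.sum_congr rfl fun σ _ => ?_
  rw [AlternatingMap.compLinearMap_apply]
  have hdet := Matrix.det_apply' (Matrix.of fun i j => b.coord (σ j) (v i))
  refine Eq.trans ?_ (congrArg (τ (b ∘ σ) * ·) hdet.symm)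
  rw [Finset.mul_sum]
  refine Finset.sum_congr rfl fun π _ => ?_
  simp only [Matrix.of_apply]
  ring

end LinearAlgebra

/-! ### Orders of vanishing -/

section RingOrder

variable {R : Type*} [CommRing R]

/-- `R/(ab)` surjects onto `R/(a)`, and length does not increase under surjections. -/
theorem ringOrd_le_ringOrd_mul (a b : R) : Ring.ord R a ≤ Ring.ord R (a * b) := by
  have hle : Ideal.span {a * b} ≤ Ideal.span {a} :=
    Ideal.span_singleton_le_span_singleton.2 (Dvd.intro b rfl)
  exact Module.length_le_of_surjective (Submodule.factor hle) (Submodule.factor_surjective hle)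

theorem orderAt_le_orderAt_mul (Q : Ideal R) [Q.IsPrime] (a b : R) :
    orderAt Q a ≤ orderAt Q (a * b) := by
  unfold orderAt
  split_ifs with h1 h2 h2
  · exact le_rfl
  · exact absurd (by rw [map_mul, h1, zero_mul]) h2
  · exact le_top
  · rw [map_mul]
    exact ringOrd_le_ringOrd_mul _ _

theorem orderAt_one (Q : Ideal R) [Q.IsPrime] : orderAt Q 1 = 0 := by
  simp [orderAt]

/-- If `g` divides `ξ`, the order of `ξ / g` is non-negative. -/
theorem IsOrderOfFraction.nonneg {Q : Ideal R} [Q.IsPrime] {ξ g : R} {m : WithTop ℤ}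
    (h : IsOrderOfFraction Q ξ g m) (hdvd : g ∣ ξ) : 0 ≤ m := by
  obtain ⟨a, rfl⟩ := hdvd
  obtain ⟨hg, hm⟩ := h
  have hle := orderAt_le_orderAt_mul Q g a
  obtain ⟨c, hc⟩ := ENat.ne_top_iff_exists.1 hg
  rw [← hc] at hle hm
  cases m with
  | top => exact le_top
  | coe m =>
    generalize orderAt Q (g * a) = d at hle hm
    induction d using ENat.recTopCoe with
    -- With `m` and the order of `g` finite, the order of the numerator cannot be infinite.
    | top =>
      exact absurd hm (by
        change (⊤ : WithTop ℤ) ≠ ((m : WithTop ℤ) + ((c : ℤ) : WithTop ℤ))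
        rw [← WithTop.coe_add]
        exact WithTop.top_ne_coe)
    | coe d =>
      have h1 : ((d : ℤ) : WithTop ℤ) = (m : WithTop ℤ) + ((c : ℤ) : WithTop ℤ) := hm
      rw [← WithTop.coe_add, WithTop.coe_inj] at h1
      have h2 : c ≤ d := by exact_mod_cast hle
      have : 0 ≤ m := by omega
      exact_mod_cast this

end RingOrder

/-! ### Holomorphic functions and forms -/

section Holomorphic

variable {n : ℕ} {X : Type*} [TopologicalSpace X] [ChartedSpace (Mdl n) X]

theorem HolAt.mdifferentiableAt {f : X → ℂ} {x : X} (hf : HolAt n f x) :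
    MDifferentiableAt 𝓘(ℂ, Mdl n) 𝓘(ℂ) f x :=
  ContMDiffAt.mdifferentiableAt hf (by simp)

theorem HolAt.add {f g : X → ℂ} {x : X} (hf : HolAt n f x) (hg : HolAt n g x) :
    HolAt n (fun y => f y + g y) x := ContMDiffAt.add hf hg

theorem HolAt.sub {f g : X → ℂ} {x : X} (hf : HolAt n f x) (hg : HolAt n g x) :
    HolAt n (fun y => f y - g y) x := ContMDiffAt.sub hf hg

theorem HolAt.mul {f g : X → ℂ} {x : X} (hf : HolAt n f x) (hg : HolAt n g x) :
    HolAt n (fun y => f y * g y) x := ContMDiffAt.mul hf hg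

theorem holAt_const (c : ℂ) (x : X) : HolAt n (fun _ : X => c) x := contMDiffAt_const

theorem HolAt.div {f g : X → ℂ} {x : X} (hf : HolAt n f x) (hg : HolAt n g x) (h : g x ≠ 0) :
    HolAt n (fun y => f y / g y) x := ContMDiffAt.div₀ hf hg h

theorem HolAt.congr {f g : X → ℂ} {x : X} (hf : HolAt n f x) (h : ∀ᶠ y in 𝓝 x, g y = f y) :
    HolAt n g x := ContMDiffAt.congr_of_eventuallyEq hf h

theorem HolAt.eventually [IsManifold 𝓘(ℂ, Mdl n) ⊤ X] {f : X → ℂ} {x : X} (hf : HolAt n f x) :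
    ∀ᶠ y in 𝓝 x, HolAt n f y :=
  (contMDiffAt_iff_contMDiffAt_nhds (by simp)).1 hf

theorem HolAt.continuousAt {f : X → ℂ} {x : X} (hf : HolAt n f x) : ContinuousAt f x :=
  ContMDiffAt.continuousAt hf

theorem dAt_congr {f g : X → ℂ} {x : X} (h : ∀ᶠ y in 𝓝 x, f y = g y) :
    dAt n f x = dAt n g x := by
  unfold dAt
  rw [Filter.EventuallyEq.mfderiv_eq h]

theorem dAt_add {f g : X → ℂ} {x : X} (hf : HolAt n f x) (hg : HolAt n g x) :
    dAt n (fun y => f y + g y) x = dAt n f x + dAt n g x := by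
  have h := (hf.mdifferentiableAt.hasMFDerivAt.add hg.mdifferentiableAt.hasMFDerivAt).mfderiv
  ext v
  exact congrArg (fun l : Mdl n →L[ℂ] ℂ => l v) h

/-- The Leibniz rule for `c f` at a zero of `f`. -/
theorem dAt_mul_of_eq_zero {c f : X → ℂ} {x : X} (hc : HolAt n c x) (hf : HolAt n f x)
    (h0 : f x = 0) : dAt n (fun y => c y * f y) x = c x • dAt n f x := by
  have h := (hc.mdifferentiableAt.hasMFDerivAt.mul hf.mdifferentiableAt.hasMFDerivAt).mfderiv
  rw [h0] at h
  ext v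
  exact (congrArg (fun l : Mdl n →L[ℂ] ℂ => l v) h).trans
    (by ring : c x * dAt n f x v + 0 * dAt n c x v = c x * dAt n f x v)

theorem holAt_sum {α : Type*} (s : Finset α) {f : α → X → ℂ} {x : X}
    (hf : ∀ i, HolAt n (f i) x) : HolAt n (fun y => ∑ i ∈ s, f i y) x := by
  classical
  induction s using Finset.induction_on with
  | empty => simpa using holAt_const 0 x
  | insert a s ha ih =>
    simp only [Finset.sum_insert ha]
    exact (hf a).add ih

/-- At a common zero the Leibniz terms containing `d(c i)` drop out. Hence elements of the ideal of
the `f i` have differentials in the span of the `df i`. -/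
theorem dAt_sum_mul {α : Type*} (s : Finset α) {c f : α → X → ℂ} {x : X}
    (hc : ∀ i, HolAt n (c i) x) (hf : ∀ i, HolAt n (f i) x) (h0 : ∀ i, f i x = 0) :
    dAt n (fun y => ∑ i ∈ s, c i y * f i y) x = ∑ i ∈ s, c i x • dAt n (f i) x := by
  classical
  induction s using Finset.induction_on with
  | empty =>
    simp only [Finset.sum_empty]
    exact congrArg ContinuousLinearMap.toLinearMap
      (hasMFDerivAt_const (I := 𝓘(ℂ, Mdl n)) (I' := 𝓘(ℂ)) (0 : ℂ) x).mfderiv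
  | insert a s ha ih =>
    simp only [Finset.sum_insert ha]
    rw [dAt_add ((hc a).mul (hf a)) (holAt_sum s fun i => (hc i).mul (hf i)),
      dAt_mul_of_eq_zero (hc a) (hf a) (h0 a), ih]

variable {p : ℕ}

theorem isOpen_chart_preimage (x₀ : X) {W : Set X} (hW : IsOpen W) :
    IsOpen ((chartAt (Mdl n) x₀).target ∩ (chartAt (Mdl n) x₀).symm ⁻¹' W) :=
  (chartAt (Mdl n) x₀).isOpen_inter_preimage_symm hW

theorem HolFormOn.mono {θ : FormField n p X} {W W' : Set X} (h : HolFormOn θ W) (hW : W' ⊆ W) :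
    HolFormOn θ W' :=
  fun x₀ v => (h x₀ v).mono (Set.inter_subset_inter_right _ (Set.preimage_mono hW))

theorem HolFormOn.sum {α : Type*} {s : Finset α} {θ : α → FormField n p X} {W : Set X}
    (h : ∀ a, HolFormOn (θ a) W) : HolFormOn (fun y => ∑ a ∈ s, θ a y) W := by
  intro x₀ v
  refine (ContDiffOn.sum (s := s) fun a _ => h a x₀ v).congr fun z _ => ?_
  exact alternatingMap_sum_apply s (fun a => θ a ((chartAt (Mdl n) x₀).symm z)) _

theorem dWedge_apply {k : ℕ} (f : Fin k → X → ℂ) (x : X) (v : Fin k → TS n x) :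
    dWedge f x v = Matrix.det (Matrix.of fun i j => dAt n (f j) x (v i)) := rfl

variable [IsManifold 𝓘(ℂ, Mdl n) ⊤ X]

theorem mdifferentiableAt_chart_symm (x₀ : X) {z : Mdl n} (hz : z ∈ (chartAt (Mdl n) x₀).target) :
    MDifferentiableAt 𝓘(ℂ, Mdl n) 𝓘(ℂ, Mdl n) (chartAt (Mdl n) x₀).symm z :=
  ((contMDiffOn_chart_symm (I := 𝓘(ℂ, Mdl n)) (n := ⊤) (x := x₀)).contMDiffAt
    ((chartAt (Mdl n) x₀).open_target.mem_nhds hz)).mdifferentiableAt (by simp)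

/-- A holomorphic function is holomorphic in charts. -/
theorem HolOn.contDiffOn_chart {u : X → ℂ} {W : Set X} (hu : HolOn n u W) (x₀ : X) :
    ContDiffOn ℂ ⊤ (fun z => u ((chartAt (Mdl n) x₀).symm z))
      ((chartAt (Mdl n) x₀).target ∩ (chartAt (Mdl n) x₀).symm ⁻¹' W) := by
  intro z hz
  have h1 : ContMDiffAt 𝓘(ℂ, Mdl n) 𝓘(ℂ, Mdl n) ⊤ (chartAt (Mdl n) x₀).symm z :=
    (contMDiffOn_chart_symm (I := 𝓘(ℂ, Mdl n)) (n := ⊤) (x := x₀)).contMDiffAt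
      ((chartAt (Mdl n) x₀).open_target.mem_nhds hz.1)
  have h2 : ContMDiffAt 𝓘(ℂ, Mdl n) 𝓘(ℂ) ⊤ (u ∘ (chartAt (Mdl n) x₀).symm) z :=
    ContMDiffAt.comp z (hu _ hz.2) h1
  exact h2.contDiffAt.contDiffWithinAt

/-- The differential of a holomorphic function is holomorphic in charts. -/
theorem HolOn.contDiffOn_dAt_chart {u : X → ℂ} {W : Set X} (hW : IsOpen W) (hu : HolOn n u W)
    (x₀ : X) (v : Mdl n) :
    ContDiffOn ℂ ⊤ (fun z : Mdl n => dAt n u ((chartAt (Mdl n) x₀).symm z)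
        (mfderiv 𝓘(ℂ, Mdl n) 𝓘(ℂ, Mdl n) (chartAt (Mdl n) x₀).symm z v))
      ((chartAt (Mdl n) x₀).target ∩ (chartAt (Mdl n) x₀).symm ⁻¹' W) := by
  have h := ((hu.contDiffOn_chart x₀).fderiv_of_isOpen (m := ⊤) (isOpen_chart_preimage x₀ hW)
    le_top).clm_apply (contDiffOn_const (c := v))
  refine h.congr fun z hz => ?_
  have hcomp := mfderiv_comp z (hu _ hz.2).mdifferentiableAt (mdifferentiableAt_chart_symm x₀ hz.1)
  rw [mfderiv_eq_fderiv] at hcomp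
  exact (congrArg (fun l : Mdl n →L[ℂ] ℂ => l v) hcomp).symm

theorem HolFormOn.smul {θ : FormField n p X} {c : X → ℂ} {W : Set X} (hc : HolOn n c W)
    (h : HolFormOn θ W) : HolFormOn (fun y => c y • θ y) W :=
  fun x₀ v => (hc.contDiffOn_chart x₀).mul (h x₀ v)

/-- The form `df₁ ∧ ⋯ ∧ dfₖ` is holomorphic if the functions are. -/
theorem holFormOn_dWedge {k : ℕ} {f : Fin k → X → ℂ} {W : Set X} (hW : IsOpen W)
    (hf : ∀ i, HolOn n (f i) W) : HolFormOn (dWedge (n := n) f) W := by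
  intro x₀ v
  refine (ContDiffOn.sum fun (σ : Equiv.Perm (Fin k)) (_ : σ ∈ Finset.univ) =>
    (contDiffOn_const (c := ((σ.sign : ℤ) : ℂ))).mul (contDiffOn_prod fun i (_ : i ∈ Finset.univ) =>
      (hf i).contDiffOn_dAt_chart hW x₀ (v (σ i)))).congr fun z _ => ?_
  rw [dWedge_apply, Matrix.det_apply']
  rfl

end Holomorphic

/-! ### Chart frames and coordinate differentials -/

section Frame

variable {n : ℕ} {X : Type*} [TopologicalSpace X] [ChartedSpace (Mdl n) X]

/-- The value at `y` of the vector field which is constant equal to `v` in the chart at `x`. -/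
def chartVec (x y : X) (v : Mdl n) : TS n y :=
  (mfderiv 𝓘(ℂ, Mdl n) 𝓘(ℂ, Mdl n) (chartAt (Mdl n) x).symm (chartAt (Mdl n) x y) :
    Mdl n →L[ℂ] Mdl n) v

variable [IsManifold 𝓘(ℂ, Mdl n) ⊤ X]

/-- The coefficients of a holomorphic form on the constant vectors of a chart are holomorphic. -/
theorem HolFormOn.holAt_coeff {p : ℕ} {θ : FormField n p X} {W : Set X} (hW : IsOpen W)
    (h : HolFormOn θ W) {x : X} (hx : x ∈ W) (v : Fin p → Mdl n) :
    HolAt n (fun y => θ y (fun j => chartVec x y (v j))) x := by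
  set φ := chartAt (Mdl n) x
  have hxs : x ∈ φ.source := mem_chart_source _ x
  have h1 : ContMDiffAt 𝓘(ℂ, Mdl n) 𝓘(ℂ) ⊤ _ (φ x) := ((h x v).contDiffAt
    ((isOpen_chart_preimage x hW).mem_nhds
      ⟨φ.map_source hxs, by simpa [φ, φ.left_inv hxs] using hx⟩)).contMDiffAt
  have h2 : ContMDiffAt 𝓘(ℂ, Mdl n) 𝓘(ℂ, Mdl n) ⊤ φ x :=
    (contMDiffOn_chart (I := 𝓘(ℂ, Mdl n)) (n := ⊤) (x := x)).contMDiffAt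
      (φ.open_source.mem_nhds hxs)
  refine HolAt.congr (ContMDiffAt.comp x h1 h2) ?_
  filter_upwards [φ.open_source.mem_nhds hxs] with y hy
  -- The base point `φ.symm (φ y)` equals `y` only propositionally; all tangent spaces unfold to the
  -- model space, so one tuple `w` can be read at both points.
  have hcast : ∀ y' : X, y' = y → ∀ w : Fin p → Mdl n, θ y w = θ y' w := by
    rintro _ rfl w
    rfl
  exact hcast _ (φ.left_inv hy) _

theorem mdifferentiable_chartAt (x : X) :
    (chartAt (Mdl n) x).MDifferentiable 𝓘(ℂ, Mdl n) 𝓘(ℂ, Mdl n) := by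
  have : IsManifold 𝓘(ℂ, Mdl n) 1 X := IsManifold.of_le (n := ⊤) le_top
  exact mdifferentiable_chart x

theorem chartVec_surjective (x : X) {y : X} (hy : y ∈ (chartAt (Mdl n) x).source) :
    Function.Surjective (chartVec (n := n) x y) :=
  ((mdifferentiable_chartAt x).mfderiv hy).symm.surjective

/-- The identification of the model space with the tangent space at `y` by the chart at `x`. -/
def chartEquiv (x : X) {y : X} (hy : y ∈ (chartAt (Mdl n) x).source) : Mdl n ≃ₗ[ℂ] TS n y :=
  ((mdifferentiable_chartAt x).mfderiv hy).symm.toLinearEquiv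

/-- The basis of the tangent space at `y` given by the chart at `x`. -/
def chartFrame (x : X) {y : X} (hy : y ∈ (chartAt (Mdl n) x).source) :
    Module.Basis (Fin n) ℂ (TS n y) :=
  (EuclideanSpace.basisFun (Fin n) ℂ).toBasis.map (chartEquiv x hy)

theorem chartFrame_apply (x : X) {y : X} (hy : y ∈ (chartAt (Mdl n) x).source) (a : Fin n) :
    chartFrame x hy a = chartVec x y (EuclideanSpace.single a 1) := by
  rw [chartFrame, Module.Basis.map_apply, OrthonormalBasis.coe_toBasis,
    EuclideanSpace.basisFun_apply]
  rfl

/-- The `a`-th coordinate function of the chart at `x`. -/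
def chartCoord (x : X) (a : Fin n) (y : X) : ℂ := chartAt (Mdl n) x y a

theorem chartCoord_holOn (x : X) (a : Fin n) :
    HolOn n (chartCoord x a) (chartAt (Mdl n) x).source := by
  intro y hy
  have h2 : ContMDiffAt 𝓘(ℂ, Mdl n) 𝓘(ℂ, Mdl n) ⊤ (chartAt (Mdl n) x) y :=
    (contMDiffOn_chart (I := 𝓘(ℂ, Mdl n)) (n := ⊤) (x := x)).contMDiffAt
      ((chartAt (Mdl n) x).open_source.mem_nhds hy)
  have h1 : ContMDiff 𝓘(ℂ, Mdl n) 𝓘(ℂ) ⊤ (EuclideanSpace.proj a : Mdl n →L[ℂ] ℂ) :=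
    (EuclideanSpace.proj a : Mdl n →L[ℂ] ℂ).contDiff.contMDiff
  exact h1.contMDiffAt.comp y h2

/-- It turns the determinants of `factorial_smul_eq_sum` into wedge products of differentials of
holomorphic functions. -/
theorem dAt_chartCoord (x : X) {y : X} (hy : y ∈ (chartAt (Mdl n) x).source) (a : Fin n) :
    dAt n (chartCoord x a) y = (chartFrame x hy).coord a := by
  have h2 := (mdifferentiable_chartAt (n := n) x).mdifferentiableAt hy
  have h1 : HasMFDerivAt 𝓘(ℂ, Mdl n) 𝓘(ℂ) (EuclideanSpace.proj a : Mdl n →L[ℂ] ℂ)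
      (chartAt (Mdl n) x y) (EuclideanSpace.proj a : Mdl n →L[ℂ] ℂ) :=
    (EuclideanSpace.proj a : Mdl n →L[ℂ] ℂ).hasMFDerivAt
  have h3 := (h1.comp y h2.hasMFDerivAt).mfderiv
  unfold dAt
  ext v
  refine (congrArg (fun l : Mdl n →L[ℂ] ℂ => l v) h3).trans ?_
  have hv : (chartFrame x hy).coord a v = (chartEquiv x hy).symm v a := by
    rw [chartFrame, Module.Basis.coord_apply, Module.Basis.map_repr]
    rfl
  exact hv.symm

end Frame

/-! ### Local equations at regular points -/

section Regular

variable {n : ℕ} {X : Type*} [TopologicalSpace X] [ChartedSpace (Mdl n) X]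

/-- At a regular point of codimension `k` the differentials of local equations are independent. -/
theorem IsLocalEquations.linearIndependent_dAt {k : ℕ} {V W : Set X} {f : Fin k → X → ℂ}
    (hf : IsLocalEquations (n := n) V W f) {x : X} (hxW : x ∈ W) (hx : IsRegularPoint n V x k) :
    LinearIndependent ℂ (fun i => dAt n (f i) x) := by
  obtain ⟨hxV, W', hW', hxW', h, hh, hzero, hind⟩ := hx
  have hf0 : ∀ i, f i x = 0 := (hf.zeros.subset ⟨hxV, hxW⟩).2
  have hmem : ∀ i, dAt n (h i) x ∈ Submodule.span ℂ (Set.range fun i => dAt n (f i) x) := by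
    intro i
    obtain ⟨c, hc, hcf⟩ := hf.generates x ⟨hxV, hxW⟩ (h i) (hh i x hxW') (by
      filter_upwards [self_mem_nhdsWithin, mem_nhdsWithin_of_mem_nhds (hW'.mem_nhds hxW')]
        with z hzV hzW
      exact (hzero.subset ⟨hzV, hzW⟩).2 i)
    rw [dAt_congr hcf, dAt_sum_mul _ hc (fun i => hf.hol i x hxW) hf0]
    exact Submodule.sum_mem _ fun j _ => Submodule.smul_mem _ _ (Submodule.subset_span ⟨j, rfl⟩)
  have : FiniteDimensional ℂ (Submodule.span ℂ (Set.range fun i => dAt n (f i) x)) :=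
    FiniteDimensional.span_of_finite ℂ (Set.finite_range _)
  -- Dimension count: the `k` independent `dh i` lie in the span of the `k` forms `df i`.
  rw [linearIndependent_iff_card_le_finrank_span, Set.finrank, ← Set.finrank]
  rw [linearIndependent_iff_card_le_finrank_span] at hind
  refine hind.trans (Submodule.finrank_mono (Submodule.span_le.2 ?_))
  rintro _ ⟨i, rfl⟩
  exact hmem i

end Regular

/-! ### Aleksandrov–Saito decompositions at regular points -/

section Decomposition

variable {n : ℕ} {X : Type*} [TopologicalSpace X] [ChartedSpace (Mdl n) X]

/-- A linear relation is a kernel vector of an invertible matrix. Since non-vanishing on a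
chart-constant tuple is an open condition, independence spreads from `x` to nearby points. -/
theorem linearIndependent_of_dWedge_ne_zero {k : ℕ} {f : Fin k → X → ℂ} {y : X}
    {v : Fin k → TS n y} (h : dWedge f y v ≠ 0) :
    LinearIndependent ℂ (fun i => dAt n (f i) y) := by
  rw [dWedge_apply] at h
  refine Fintype.linearIndependent_iff.2 fun c hc => congrFun (f := c) (g := 0)
    (Matrix.eq_zero_of_mulVec_eq_zero h ?_)
  funext i
  have := congrArg (fun l : TS n y →ₗ[ℂ] ℂ => l (v i)) hc
  simp only [LinearMap.sum_apply, LinearMap.smul_apply, smul_eq_mul, LinearMap.zero_apply] at this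
  simpa [Matrix.mulVec, dotProduct, mul_comm] using this

theorem IsIrreducibleComponent.isRegularPoint {k : ℕ} {A V S : Set X}
    (hV : IsReducedLCI n V k) (hS : IsIrreducibleComponent n (A ∩ V) S)
    (hdisj : Disjoint S (singularLocus n V)) {x : X} (hx : x ∈ S) : IsRegularPoint n V x k := by
  have hxV : x ∈ V := (hS.prop.2 hx).2
  by_contra hreg
  refine Set.disjoint_left.1 hdisj hx ⟨hxV, ?_⟩
  rintro ⟨r, hr⟩
  exact hreg (hV.pure_codim x r hr ▸ hr)

/-- A representative of the germ `1` takes the value `1` at `x` itself, which lies in `S`.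
Properness supplies the minimal primes, that is, the local components of `S`. -/
theorem idealOf_ne_top {V S : Set X} (hSV : S ⊆ V) {x : X} (hx : x ∈ S) :
    idealOf n V S x ≠ ⊤ := by
  rw [Ne, Ideal.eq_top_iff_one]
  rintro ⟨f, hf, hf0⟩
  have h1 : ∀ᶠ z in 𝓝[V] x, f z = 1 := Filter.Germ.coe_eq.1 hf
  have h2 := h1.self_of_nhdsWithin (hSV hx)
  rw [hf0.self_of_nhdsWithin hx] at h2
  exact zero_ne_one h2

variable [IsManifold 𝓘(ℂ, Mdl n) ⊤ X]

/-- Vectors dual to the `df i` give determinant one at `x`; writing them through the chart extends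
them to nearby points. -/
theorem IsLocalEquations.exists_dWedge_ne_zero {k : ℕ} {V W : Set X} {f : Fin k → X → ℂ}
    (hf : IsLocalEquations (n := n) V W f) {x : X} (hxW : x ∈ W) (hx : IsRegularPoint n V x k) :
    ∃ t : Fin k → Mdl n, dWedge f x (fun j => chartVec x x (t j)) ≠ 0 := by
  obtain ⟨T, hT⟩ := exists_dual_family (hf.linearIndependent_dAt hxW hx)
  choose t ht using fun j => chartVec_surjective x (mem_chart_source (Mdl n) x) (T j)
  refine ⟨t, ?_⟩
  have h1 : (Matrix.of fun i j => dAt n (f j) x (chartVec x x (t i))) = 1 := by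
    ext i j
    rw [Matrix.of_apply, ht, hT, Matrix.one_apply]
    simp only [eq_comm]
  rw [dWedge_apply, h1, Matrix.det_one]
  exact one_ne_zero

/-- At a regular point of `V`, the function `g` divides `ξ` in the local ring of `V`. -/
theorem IsASDecomposition.restrict_dvd {k : ℕ} {ι : Type*} {Ω : PfaffSystem n k X ι}
    {V W : Set X} {α : ι} {f : Fin k → X → ℂ} {g ξ : X → ℂ} {η : Fin k → FormField n k X}
    (D : IsASDecomposition Ω V α W f g ξ η) {x : X} (hxW : x ∈ W)
    (hx : IsRegularPoint n V x k) :
    restrict V (D.hol_g x hxW) ∣ restrict V (D.hol_ξ x hxW) := by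
  obtain ⟨t, ht⟩ := D.equations.exists_dWedge_ne_zero hxW hx
  have hW := D.equations.isOpen
  have hδ := (holFormOn_dWedge hW D.equations.hol).holAt_coeff hW hxW t
  have hw := ((Ω.hol_form α).mono D.subset).holAt_coeff hW hxW t
  refine ⟨restrict V (hw.div hδ ht), Subtype.ext (Filter.Germ.coe_eq.2 ?_)⟩
  filter_upwards [self_mem_nhdsWithin, mem_nhdsWithin_of_mem_nhds (hW.mem_nhds hxW),
    mem_nhdsWithin_of_mem_nhds (hδ.continuousAt.eventually_ne ht)] with y hyV hyW hy
  have hf0 : ∀ i, f i y = 0 := (D.equations.zeros.subset ⟨hyV, hyW⟩).2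
  have h := congrArg (fun θ => θ fun j => chartVec x y (t j)) (D.decomp y hyW)
  simp only [hf0, zero_smul, Finset.sum_const_zero, add_zero, AlternatingMap.smul_apply,
    smul_eq_mul] at h
  rw [mul_div_assoc', h, mul_div_assoc, div_self hy, mul_one]

/-- Near a regular point, a logarithmic form has an Aleksandrov-Saito decomposition with
`g = 1`. -/
theorem exists_isASDecomposition {k : ℕ} {ι : Type*} (Ω : PfaffSystem n k X ι)
    {V W : Set X} {α : ι} {f : Fin k → X → ℂ} (hWU : W ⊆ Ω.U α)
    (hf : IsLocalEquations (n := n) V W f)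
    (hlog : ∀ y ∈ V ∩ W, ∀ i, wedgeDf (f i) y (Ω.form α y) = 0)
    {x : X} (hxW : x ∈ W) (hx : IsRegularPoint n V x k) :
    ∃ (W' : Set X) (ξ : X → ℂ) (η : Fin k → FormField n k X),
      x ∈ W' ∧ IsASDecomposition Ω V α W' f (fun _ => 1) ξ η := by
  obtain ⟨t, ht⟩ := hf.exists_dWedge_ne_zero hxW hx
  have hW := hf.isOpen
  have hδh := holFormOn_dWedge hW hf.hol
  have hωh := (Ω.hol_form α).mono hWU
  have hδ := hδh.holAt_coeff hW hxW t
  obtain ⟨ξ, hξ, hξeq⟩ : ∃ ξ : X → ℂ, HolAt n ξ x ∧ ∀ y, ξ y =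
      Ω.form α y (fun j => chartVec x y (t j)) / dWedge f y (fun j => chartVec x y (t j)) :=
    ⟨_, (hωh.holAt_coeff hW hxW t).div hδ ht, fun _ => rfl⟩
  let e : (Fin k → Fin n) → Fin k → Mdl n := fun σ j => EuclideanSpace.single (σ j) 1
  -- On `V` near `x` the form `ω - ξ df₁ ∧ ⋯ ∧ dfₖ` is zero, so each of its coefficients lies in the
  -- ideal of `V` at `x`.
  have hcoeff : ∀ σ : Fin k → Fin n, ∃ c : Fin k → X → ℂ, (∀ i, HolAt n (c i) x) ∧
      ∀ᶠ y in 𝓝 x, Ω.form α y (fun j => chartVec x y (e σ j)) -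
        ξ y * dWedge f y (fun j => chartVec x y (e σ j)) = ∑ i, c i y * f i y := by
    intro σ
    refine hf.generates x ⟨hx.1, hxW⟩ _ ((hωh.holAt_coeff hW hxW (e σ)).sub
      (hξ.mul (hδh.holAt_coeff hW hxW (e σ)))) ?_
    filter_upwards [self_mem_nhdsWithin, mem_nhdsWithin_of_mem_nhds (hW.mem_nhds hxW),
      mem_nhdsWithin_of_mem_nhds (hδ.continuousAt.eventually_ne ht)] with y hyV hyW hy
    have h := det_mul_eq_of_wedge_eq_zero (linearIndependent_of_dWedge_ne_zero hy)
      (hlog y ⟨hyV, hyW⟩) (fun j => chartVec x y (t j)) (fun j => chartVec x y (e σ j))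
    change dWedge f y _ * _ = _ * dWedge f y _ at h
    rw [sub_eq_zero, hξeq, div_mul_eq_mul_div, eq_div_iff hy, ← h, mul_comm]
  choose c hc hceq using hcoeff
  obtain ⟨W', hW'sub, hW', hxW'⟩ := mem_nhds_iff.1 (Filter.inter_mem (Filter.inter_mem
    (Filter.inter_mem (hW.mem_nhds hxW)
      ((chartAt (Mdl n) x).open_source.mem_nhds (mem_chart_source _ x))) hξ.eventually)
    (Filter.inter_mem (Filter.eventually_all.2 hceq)
      (Filter.eventually_all.2 fun σ => Filter.eventually_all.2 fun i => (hc σ i).eventually)))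
  have hW'W : W' ⊆ W := fun y hy => (hW'sub hy).1.1.1
  have hW's : W' ⊆ (chartAt (Mdl n) x).source := fun y hy => (hW'sub hy).1.1.2
  have hfac : (k.factorial : ℂ) ≠ 0 := Nat.cast_ne_zero.2 k.factorial_ne_zero
  -- `η i` collects the multiples of `f i` in the coordinate expansion of that form. The sum runs
  -- over all maps `σ`, not only increasing ones, whence the factor `1 / k!`.
  refine ⟨W', ξ, fun i y => ∑ σ : Fin k → Fin n, ((k.factorial : ℂ)⁻¹ * c σ i y) •
    dWedge (fun j => chartCoord x (σ j)) y, hxW', hW'W.trans hWU, ⟨hW', ?_, ?_, ?_⟩,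
    fun y _ => holAt_const 1 y, fun y hy => (hW'sub hy).1.2, fun i => ?_, ?_, fun y hy => ?_⟩
  · exact fun i y hy => hf.hol i y (hW'W hy)
  · ext y
    constructor
    · rintro ⟨hyV, hy⟩
      exact ⟨hy, (hf.zeros.subset ⟨hyV, hW'W hy⟩).2⟩
    · rintro ⟨hy, hy0⟩
      exact ⟨(hf.zeros.superset ⟨hW'W hy, hy0⟩).1, hy⟩
  · exact fun y hy => hf.generates y ⟨hy.1, hW'W hy.2⟩
  · refine HolFormOn.sum fun σ => HolFormOn.smul
      (fun y hy => (holAt_const _ y).mul ((hW'sub hy).2.2 σ i)) (holFormOn_dWedge hW' ?_)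
    exact fun j y hy => chartCoord_holOn x (σ j) y (hW's hy)
  · exact fun y hy => subset_closure ⟨hy, one_ne_zero⟩
  · have hys := hW's hy
    set τ : (TS n y) [⋀^Fin k]→ₗ[ℂ] ℂ := Ω.form α y - ξ y • dWedge f y with hτ
    have hexp := factorial_smul_eq_sum (chartFrame x hys) τ
    have hterm : ∀ σ : Fin k → Fin n,
        τ (chartFrame x hys ∘ σ) = ∑ i, c σ i y * f i y := by
      intro σ
      have hσ : chartFrame x hys ∘ σ = fun j => chartVec x y (e σ j) :=
        funext fun j => chartFrame_apply x hys (σ j)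
      rw [hσ, ← (hW'sub hy).2.1 σ]
      rfl
    have hwedge : ∀ σ : Fin k → Fin n, Matrix.detRowAlternating.compLinearMap
        (LinearMap.pi fun i => (chartFrame x hys).coord (σ i)) =
        dWedge (fun j => chartCoord x (σ j)) y := by
      intro σ
      unfold dWedge
      simp only [dAt_chartCoord x hys]
    simp only [hterm, hwedge] at hexp
    have hmain : τ = ∑ i, f i y • ∑ σ : Fin k → Fin n,
        ((k.factorial : ℂ)⁻¹ * c σ i y) • dWedge (fun j => chartCoord x (σ j)) y := by
      rw [← inv_smul_smul₀ hfac τ, hexp]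
      simp only [Finset.smul_sum, Finset.sum_smul, smul_smul]
      rw [Finset.sum_comm]
      refine Finset.sum_congr rfl fun i _ => Finset.sum_congr rfl fun σ _ => ?_
      congr 1
      ring
    rw [one_smul, ← hmain, hτ]
    abel

end Decomposition

end PfaffGSV

end

theorem mainTheorem3 {n k : ℕ} (hk : 1 ≤ k) (hkn : k ≤ n)
    {X : Type*} [TopologicalSpace X] [T2Space X] [ChartedSpace (PfaffGSV.Mdl n) X]
    [IsManifold (modelWithCornersSelf ℂ (PfaffGSV.Mdl n)) ⊤ X]
    {ι : Type*} (Ω : PfaffGSV.PfaffSystem n k X ι)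
    (V : Set X) (hV : PfaffGSV.IsReducedLCI n V k) (hinv : Ω.IsInvariant V)
    (S : Set X) (hS : PfaffGSV.IsIrreducibleComponent n (Ω.sing ∩ V) S)
    (hdisj : Disjoint S (PfaffGSV.singularLocus n V)) :
    (∀ m : WithTop ℤ, PfaffGSV.IsGSVIndex Ω V S m → 0 ≤ m) ∧
    (Ω.IsLogarithmicAlong V k → ∃ m : WithTop ℤ, PfaffGSV.IsGSVIndex Ω V S m) := by
  refine ⟨?_, fun hlog => ?_⟩
  · rintro m ⟨α, W, f, g, ξ, η, D, x, hxS, hxW, Q, hQ, -, hm⟩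
    exact hm.nonneg (D.restrict_dvd hxW (hS.isRegularPoint hV hdisj hxS))
  · obtain ⟨x, hxS⟩ := hS.prop.1.2.1
    have hSV : S ⊆ V := fun y hy => (hS.prop.2 hy).2
    obtain ⟨α, W, f, θ, hxW, hWU, hf, -, hθ⟩ := hlog x (hSV hxS)
    have hwedge : ∀ y ∈ V ∩ W, ∀ i, PfaffGSV.wedgeDf (f i) y (Ω.form α y) = 0 := by
      intro y hy i
      have hf0 : ∀ i, f i y = 0 := (hf.zeros.subset hy).2
      rw [hθ i y hy.2]
      simp [hf0]
    obtain ⟨W', ξ, η, hxW', D⟩ := PfaffGSV.exists_isASDecomposition Ω hWU hf hwedge hxW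
      (hS.isRegularPoint hV hdisj hxS)
    obtain ⟨Q, hQ⟩ := Ideal.nonempty_minimalPrimes (PfaffGSV.idealOf_ne_top (n := n) hSV hxS)
    have hQp : Q.IsPrime := hQ.1.1
    -- Here `g = 1` has order zero, so the index is the order of `ξ`, possibly infinite.
    have hone : PfaffGSV.orderAt Q (PfaffGSV.restrict V (D.hol_g x hxW')) = 0 :=
      PfaffGSV.orderAt_one Q
    refine ⟨PfaffGSV.toWithTopInt (PfaffGSV.orderAt Q (PfaffGSV.restrict V (D.hol_ξ x hxW'))),
      α, W', f, _, ξ, η, D, x, hxS, hxW', Q, hQp, hQ, hone ▸ ENat.zero_ne_top, ?_⟩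
    rw [hone]
    exact (add_zero _).symm
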